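/- Let $H$ be a complex Hilbert space (not necessarily separable), $L(H)$ the algebra of bounded operators on $H$, $\mathcal R\subseteq L(H)$ a set of pairwise commuting self-adjoint operators, and $K\in L(H)$ a density operator (positive, $\operatorname{Tr}K=1$) with normal state $\rho(A)=\operatorname{Tr}(KA)$. For $\mathcal F\subseteq L(H)$ let $\mathcal F'$ be its commutant and $\mathrm{vN}(\mathcal F)$ the smallest von Neumann algebra on $H$ containing $\mathcal F$. A norm-closed unital $*$-subalgebra $\mathcal B\subseteq L(H)$ is called $\mathcal R$-beable for $K$ if * (Beable) there is a Borel probability measure $\mu$ on the space of dispersion-free (that is, multiplicative) states $\omega$ of $\mathcal B$, with the topology of pointwise convergence, such that $\rho(A)=\int\omega(A)\,d\mu(\omega)$ for all $A\in\mathcal B$; * ($\mathcal R$-Priv) $\mathcal R\subseteq\mathcal B$; * (Def) $U\mathcal BU^*=\mathcal B$ for every unitary $U\in\mathcal R'$ that fixes $\rho$, i.e. $\rho(U^*AU)=\rho(A)$ for all $A\in L(H)$ (equivalently $UKU^*=K$). It is maximal $\mathcal R$-beable for $K$ if it is maximal under inclusion among the $\mathcal R$-beable algebras for $K$. Let $S=[\mathcal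 R''\,\overline{\operatorname{range}}(K)]$, the closed linear span of the vectors $Ax$ with $A\in\mathcal R''$ and $x\in\overline{\operatorname{range}}(K)$, and let $P_S$ be the orthogonal projection of $H$ onto $S$. Operators on $S$ and on $S^\perp$ are regarded as operators on $H$ by extending them by $0$. **Theorem.** $S$ is the smallest closed subspace of $H$ that contains $\operatorname{range}(K)$ and is invariant under every element of $\mathcal R$. Every maximal $\mathcal R$-beable algebra for $K$ has the form $L(S^\perp)\oplus\mathcal M$, where $\mathcal M$ is a $*$-algebra of operators with $$\mathrm{vN}(\mathcal R)P_S\subseteq\mathcal M\subseteq\mathrm{vN}(\mathcal R\cup\{K\})P_S$$ and $\mathcal M$ is maximal abelian in $\mathrm{vN}(\mathcal R\cup\{K\})P_S$ (maximal among the commutative $*$-subalgebras of it). Conversely, for every such $\mathcal M$, the set $L(S^\perp)\oplus\mathcal M$ is a maximal $\mathcal R$-beable algebra for $K$. -/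

import Mathlib

open scoped ComplexOrder

noncomputable section

namespace BeableAlgebra

/-! ### Beable subalgebras of a unital C⋆-algebra -/

section Abstract

variable {𝔄 : Type*} [CStarAlgebra 𝔄]

/-- The space of dispersion-free states of a unital ⋆-subalgebra `B`: positive functionals `ω` on
`B` with `ω 1 = 1` such that `ω (A X) = ω A * ω X` for all `A`, `X` in `B`. It carries the topology
of pointwise convergence. -/
def dispersionFreeStates (B : StarSubalgebra ℂ 𝔄) : Set (WeakDual ℂ B) :=
  {ω | (∀ A : B, 0 ≤ ω (star A * A)) ∧ ω 1 = 1 ∧ ∀ A X : B, ω (A * X) = ω A * ω X}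

/-- The Borel σ-algebra of the topology of pointwise convergence. -/
instance (B : StarSubalgebra ℂ 𝔄) : MeasurableSpace (dispersionFreeStates B) :=
  borel (dispersionFreeStates B)

/-- `B` is beable for the state `ρ`: the restriction of `ρ` to `B` is a mixture of dispersion-free
states of `B`. -/
def IsBeable (ρ : 𝔄 → ℂ) (B : StarSubalgebra ℂ 𝔄) : Prop :=
  ∃ μ : MeasureTheory.Measure (dispersionFreeStates B), MeasureTheory.IsProbabilityMeasure μ ∧
    ∀ A : B, ρ A = ∫ ω : dispersionFreeStates B, (ω : WeakDual ℂ B) A ∂μ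

/-- The unital C⋆-subalgebra `B` is `R`-beable for the state `ρ`. -/
structure IsRBeable (R : Set 𝔄) (ρ : 𝔄 → ℂ) (B : StarSubalgebra ℂ 𝔄) : Prop where
  /-- `B` is norm-closed, i.e. a C⋆-subalgebra. -/
  isClosed : IsClosed (B : Set 𝔄)
  /-- (Beable) -/
  beable : IsBeable ρ B
  /-- (`R`-Priv) -/
  priv : R ⊆ B
  /-- (Def): `B` is invariant under conjugation by unitaries in `R'` that fix `ρ`. -/
  definable : ∀ U ∈ unitary 𝔄, U ∈ Set.centralizer R → (∀ A, ρ (star U * A * U) = ρ A) →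
    (fun A => U * A * star U) '' (B : Set 𝔄) = B

/-- `B` is maximal among the `R`-beable C⋆-subalgebras for `ρ`. -/
def IsMaximalRBeable (R : Set 𝔄) (ρ : 𝔄 → ℂ) (B : StarSubalgebra ℂ 𝔄) : Prop :=
  Maximal (IsRBeable R ρ) B

end Abstract

/-! ### Normal states, generated von Neumann algebras and the form of the algebras -/

section Hilbert

variable {H : Type*} [NormedAddCommGroup H] [InnerProductSpace ℂ H] [CompleteSpace H]

/-- The trace, computed in a Hilbert basis of `H` (on trace-class operators, and on positive
operators, it does not depend on the basis; the series is `0` by convention if not summable). -/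
def trace (A : H →L[ℂ] H) : ℂ :=
  ∑' i : (exists_hilbertBasis ℂ H).choose,
    inner ℂ ((exists_hilbertBasis ℂ H).choose_spec.choose i)
      (A ((exists_hilbertBasis ℂ H).choose_spec.choose i))

/-- Density operators: positive operators of trace `1` (the diagonal series of such an operator is
summable, as otherwise `trace K` would be `0`). -/
def IsDensityOperator (K : H →L[ℂ] H) : Prop :=
  K.IsPositive ∧ trace K = 1

/-- The normal state `A ↦ Tr (K A)` of a density operator `K`. -/
def normalState (K : H →L[ℂ] H) (A : H →L[ℂ] H) : ℂ :=
  trace (K * A)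

/-- The smallest von Neumann algebra on `H` containing the set `F`, as a set of operators. -/
def vN (F : Set (H →L[ℂ] H)) : Set (H →L[ℂ] H) :=
  ⋂ V ∈ {V : VonNeumannAlgebra H | F ⊆ V}, (V : Set (H →L[ℂ] H))

/-- The closed linear span `[R'' range K]`. -/
def privSubspace (R : Set (H →L[ℂ] H)) (K : H →L[ℂ] H) : Submodule ℂ H :=
  (Submodule.span ℂ {y | ∃ A ∈ Set.centralizer (Set.centralizer R),
    ∃ x ∈ closure (Set.range K), y = A x}).topologicalClosure

instance (R : Set (H →L[ℂ] H)) (K : H →L[ℂ] H) : CompleteSpace (privSubspace R K) :=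
  (Submodule.isClosed_topologicalClosure _).completeSpace_coe

/-- The orthogonal projection `P_S` of `H` onto `S = [R'' range K]`. -/
def privProj (R : Set (H →L[ℂ] H)) (K : H →L[ℂ] H) : H →L[ℂ] H :=
  (privSubspace R K).starProjection

/-- `M` is maximal among the abelian ⋆-subalgebras contained in `W` (maximality makes `M` closed
when `W` is closed). -/
def IsMaximalAbelianIn (W : Set (H →L[ℂ] H)) (M : NonUnitalStarSubalgebra ℂ (H →L[ℂ] H)) : Prop :=
  Maximal (fun N : NonUnitalStarSubalgebra ℂ (H →L[ℂ] H) =>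
    (N : Set (H →L[ℂ] H)) ⊆ W ∧ ∀ A ∈ N, ∀ B ∈ N, A * B = B * A) M

/-- The conditions on the summand `M`, an algebra of operators on `S` (operators on `S` are
extended by `0` to operators on `H`): `vN(R) P_S ⊆ M ⊆ vN(R, K) P_S` and `M` is maximal abelian in
`vN(R, K) P_S`. -/
structure IsAdmissible (R : Set (H →L[ℂ] H)) (K : H →L[ℂ] H)
    (M : NonUnitalStarSubalgebra ℂ (H →L[ℂ] H)) : Prop where
  lower : (fun A => A * privProj R K) '' vN R ⊆ M
  upper : (M : Set (H →L[ℂ] H)) ⊆ (fun A => A * privProj R K) '' vN (insert K R)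
  maximalAbelian : IsMaximalAbelianIn ((fun A => A * privProj R K) '' vN (insert K R)) M

/-- `L(S^⊥) ⊕ M`, as a set of operators on `H`; the elements of `L(S^⊥)`, extended by `0`, are the
operators `(1 - P_S) C (1 - P_S)` with `C` a bounded operator on `H`. -/
def directSum (R : Set (H →L[ℂ] H)) (K : H →L[ℂ] H)
    (M : NonUnitalStarSubalgebra ℂ (H →L[ℂ] H)) : Set (H →L[ℂ] H) :=
  {X | ∃ C : H →L[ℂ] H, ∃ A ∈ M, X = (1 - privProj R K) * C * (1 - privProj R K) + A}

end Hilbert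

end BeableAlgebra

end

/-!
Commutators in an `R`-beable algebra `B` have expectation zero, also after multiplication by
elements of `B` on both sides. By the Cauchy–Schwarz inequality they therefore kill the range of
`K`, and then `S`, since `R ⊆ B`. The unitaries `P_S + z (1 - P_S)` lie in `{R, K}'`, so
conjugating by them separates off the corners `P_S A (1 - P_S)` of `A ∈ B` inside `B`, and the
vanishing of commutators on `S` makes these corners zero. Likewise `A P_S` commutes with its
conjugates under all unitaries of `{R, K}'`, which forces `A P_S ∈ {R, K}''`. Hence `B` lies in
`L(S^⊥) ⊕ B P_S` with `B P_S` abelian in `vN(R, K) P_S`.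

Conversely, the state only sees the summand `M` of `L(S^⊥) ⊕ M`, and on the commutative
C⋆-algebra `M` every state is a mixture of characters, by the theorems of Gelfand and Riesz; the
unitaries in `R'` that fix the state commute with `K`, hence with `M`. Maximal `R`-beable algebras
thus correspond to maximal abelian `M`, which exist by Zorn's lemma.
-/

open scoped InnerProductSpace

namespace BeableAlgebra

section HilbertSchmidt

variable {𝕜 E F ι κ : Type*} [RCLike 𝕜] [NormedAddCommGroup E] [InnerProductSpace 𝕜 E]
  [NormedAddCommGroup F] [InnerProductSpace 𝕜 F]

theorem hasSum_norm_inner_sq (b : HilbertBasis ι 𝕜 E) (x : E) :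
    HasSum (fun i => ‖⟪b i, x⟫_𝕜‖ ^ 2) (‖x‖ ^ 2) := by
  simpa [b.repr_apply_apply] using lp.hasSum_norm (by norm_num) (b.repr x)

variable {S T : E →L[𝕜] F}

theorem summable_norm_inner_sq (b : HilbertBasis ι 𝕜 E) (c : HilbertBasis κ 𝕜 F)
    (hT : Summable fun i => ‖T (b i)‖ ^ 2) :
    Summable fun p : ι × κ => ‖⟪c p.2, T (b p.1)⟫_𝕜‖ ^ 2 := by
  rw [summable_prod_of_nonneg fun p => sq_nonneg _]
  refine ⟨fun i => (hasSum_norm_inner_sq c (T (b i))).summable, ?_⟩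
  simpa only [(hasSum_norm_inner_sq c _).tsum_eq] using hT

variable [CompleteSpace E] [CompleteSpace F]

theorem summable_norm_adjoint_sq (b : HilbertBasis ι 𝕜 E) (c : HilbertBasis κ 𝕜 F)
    (hT : Summable fun i => ‖T (b i)‖ ^ 2) : Summable fun j => ‖T.adjoint (c j)‖ ^ 2 := by
  have h := (summable_norm_inner_sq b c hT).prod_symm
  rw [summable_prod_of_nonneg fun p => sq_nonneg _] at h
  refine h.2.congr fun j => ?_
  rw [← (hasSum_norm_inner_sq b (T.adjoint (c j))).tsum_eq]
  simp only [T.adjoint_inner_right, norm_inner_symm, Prod.swap_prod_mk]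

theorem exists_hasSum_inner_adjoint (b : HilbertBasis ι 𝕜 E) (c : HilbertBasis κ 𝕜 F)
    (hS : Summable fun i => ‖S (b i)‖ ^ 2) (hT : Summable fun i => ‖T (b i)‖ ^ 2) :
    ∃ t : 𝕜, HasSum (fun i => ⟪S (b i), T (b i)⟫_𝕜) t ∧
      HasSum (fun j => ⟪T.adjoint (c j), S.adjoint (c j)⟫_𝕜) t := by
  have hsum : Summable fun p : ι × κ => ⟪S (b p.1), c p.2⟫_𝕜 * ⟪c p.2, T (b p.1)⟫_𝕜 := by
    refine .of_norm_bounded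
      ((summable_norm_inner_sq b c hS).add (summable_norm_inner_sq b c hT)) fun p => ?_
    rw [norm_mul, norm_inner_symm]
    nlinarith [sq_nonneg (‖⟪c p.2, S (b p.1)⟫_𝕜‖ - ‖⟪c p.2, T (b p.1)⟫_𝕜‖),
      norm_nonneg ⟪c p.2, S (b p.1)⟫_𝕜, norm_nonneg ⟪c p.2, T (b p.1)⟫_𝕜]
  obtain ⟨t, ht⟩ := hsum
  refine ⟨t, ht.prod_fiberwise fun i => c.hasSum_inner_mul_inner _ _,
    ((Equiv.prodComm κ ι).hasSum_iff.2 ht).prod_fiberwise fun j => ?_⟩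
  simpa [ContinuousLinearMap.adjoint_inner_left, ContinuousLinearMap.adjoint_inner_right, mul_comm]
    using b.hasSum_inner_mul_inner (T.adjoint (c j)) (S.adjoint (c j))

end HilbertSchmidt

section Trace

open ContinuousLinearMap InnerProductSpace

variable {H : Type*} [NormedAddCommGroup H] [InnerProductSpace ℂ H] [CompleteSpace H]
  {K : H →L[ℂ] H}

/-- The Hilbert basis in which `trace` is computed. -/
noncomputable def traceBasis : HilbertBasis (exists_hilbertBasis ℂ H).choose ℂ H :=
  (exists_hilbertBasis ℂ H).choose_spec.choose

theorem trace_eq (A : H →L[ℂ] H) : trace A = ∑' i, ⟪traceBasis i, A (traceBasis i)⟫_ℂ := rfl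

theorem normalState_rankOne (K : H →L[ℂ] H) (x y : H) :
    normalState K (rankOne ℂ x y) = ⟪y, K x⟫_ℂ := by
  rw [normalState, trace_eq, ← (traceBasis (H := H)).tsum_inner_mul_inner y (K x)]
  simp only [mul_apply_eq_comp, rankOne_apply, map_smul, inner_smul_right]

theorem IsDensityOperator.isSelfAdjoint (hK : IsDensityOperator K) : IsSelfAdjoint K :=
  hK.1.isSelfAdjoint

theorem IsDensityOperator.inner_eq_inner_sqrt (hK : IsDensityOperator K) (x y : H) :
    ⟪x, K y⟫_ℂ = ⟪CFC.sqrt K x, CFC.sqrt K y⟫_ℂ := by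
  have hK0 : 0 ≤ K := (nonneg_iff_isPositive K).2 hK.1
  rw [← adjoint_inner_right, (CFC.sqrt_nonneg K).isSelfAdjoint.adjoint_eq, ← mul_apply_eq_comp,
    CFC.sqrt_mul_sqrt_self K]

theorem IsDensityOperator.summable_norm_sqrt_traceBasis (hK : IsDensityOperator K) :
    Summable fun i => ‖CFC.sqrt K (traceBasis (H := H) i)‖ ^ 2 := by
  have hs : Summable fun i => ⟪traceBasis (H := H) i, K (traceBasis i)⟫_ℂ := by
    by_contra h
    exact zero_ne_one ((tsum_eq_zero_of_not_summable h).symm.trans hK.2)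
  refine (Complex.hasSum_re hs.hasSum).summable.congr fun i => ?_
  rw [hK.inner_eq_inner_sqrt, inner_self_eq_norm_sq_to_K]
  norm_cast

theorem IsDensityOperator.summable_norm_sqrt {ι : Type*} (hK : IsDensityOperator K)
    (b : HilbertBasis ι ℂ H) : Summable fun i => ‖CFC.sqrt K (b i)‖ ^ 2 := by
  simpa [(CFC.sqrt_nonneg K).isSelfAdjoint.adjoint_eq] using
    summable_norm_adjoint_sq traceBasis b hK.summable_norm_sqrt_traceBasis

theorem IsDensityOperator.exists_hasSum {ι : Type*} (hK : IsDensityOperator K)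
    (b : HilbertBasis ι ℂ H) (A : H →L[ℂ] H) :
    ∃ t : ℂ, HasSum (fun i => ⟪b i, K (A (b i))⟫_ℂ) t ∧
      HasSum (fun j => ⟪CFC.sqrt K (traceBasis j), A (CFC.sqrt K (traceBasis j))⟫_ℂ) t := by
  have hsqrt := (CFC.sqrt_nonneg K).isSelfAdjoint.adjoint_eq
  have hsqrtA : Summable fun i => ‖(CFC.sqrt K ∘L A) (b i)‖ ^ 2 := by
    have h : Summable fun i => ‖(A.adjoint ∘L CFC.sqrt K) (b i)‖ ^ 2 := by
      refine .of_nonneg_of_le (fun i => sq_nonneg _) (fun i => ?_)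
        ((hK.summable_norm_sqrt b).mul_left (‖A.adjoint‖ ^ 2))
      rw [← mul_pow]
      gcongr
      exact A.adjoint.le_opNorm _
    simpa only [adjoint_comp, hsqrt, adjoint_adjoint] using summable_norm_adjoint_sq b b h
  simpa only [adjoint_comp, hsqrt, comp_apply, ← hK.inner_eq_inner_sqrt, adjoint_inner_left] using
    exists_hasSum_inner_adjoint b traceBasis (hK.summable_norm_sqrt b) hsqrtA

theorem hasSum_sqrt_normalState (hK : IsDensityOperator K) (A : H →L[ℂ] H) :
    HasSum (fun j => ⟪CFC.sqrt K (traceBasis j), A (CFC.sqrt K (traceBasis j))⟫_ℂ)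
      (normalState K A) := by
  obtain ⟨t, ht, ht'⟩ := hK.exists_hasSum traceBasis A
  have ht_eq : normalState K A = t := ht.tsum_eq
  rwa [ht_eq]

theorem hasSum_inner_normalState {ι : Type*} (hK : IsDensityOperator K) (b : HilbertBasis ι ℂ H)
    (A : H →L[ℂ] H) : HasSum (fun i => ⟪b i, K (A (b i))⟫_ℂ) (normalState K A) := by
  obtain ⟨t, ht, ht'⟩ := hK.exists_hasSum b A
  rwa [(hasSum_sqrt_normalState hK A).unique ht']

/-- The normal state of a density operator as a linear functional. -/
noncomputable def normalStateLinearMap (hK : IsDensityOperator K) : (H →L[ℂ] H) →ₗ[ℂ] ℂ where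
  toFun := normalState K
  map_add' A B := (hasSum_sqrt_normalState hK _).unique <| by
    simpa [inner_add_right] using
      (hasSum_sqrt_normalState hK A).add (hasSum_sqrt_normalState hK B)
  map_smul' z A := (hasSum_sqrt_normalState hK _).unique <| by
    simpa [inner_smul_right] using (hasSum_sqrt_normalState hK A).mul_left z

theorem hasSum_normalState_star_mul_self (hK : IsDensityOperator K) (C : H →L[ℂ] H) :
    HasSum (fun j => ((‖C (CFC.sqrt K (traceBasis (H := H) j))‖ ^ 2 : ℝ) : ℂ))
      (normalState K (star C * C)) := by
  convert hasSum_sqrt_normalState hK (star C * C) using 2 with i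
  rw [mul_apply_eq_comp, star_eq_adjoint, adjoint_inner_right, inner_self_eq_norm_sq_to_K]
  norm_cast

theorem normalState_star_mul_self_nonneg (hK : IsDensityOperator K) (C : H →L[ℂ] H) :
    0 ≤ normalState K (star C * C) :=
  (hasSum_normalState_star_mul_self hK C).nonneg fun j => by
    exact_mod_cast sq_nonneg ‖C (CFC.sqrt K (traceBasis j))‖

theorem normalState_one (hK : IsDensityOperator K) : normalState K 1 = 1 := by
  rw [normalState, mul_one, hK.2]

theorem normalState_mul_eq_zero (hK : IsDensityOperator K) {C : H →L[ℂ] H}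
    (hC : normalState K (star C * C) = 0) (B : H →L[ℂ] H) : normalState K (B * C) = 0 := by
  have h := Complex.hasSum_ofReal.1 (hC ▸ hasSum_normalState_star_mul_self hK C)
  have hv : ∀ j, C (CFC.sqrt K (traceBasis (H := H) j)) = 0 := fun j => by
    simpa using congr_fun ((hasSum_zero_iff_of_nonneg fun i => sq_nonneg _).1 h) j
  simpa [hv] using (hasSum_sqrt_normalState hK (B * C)).tsum_eq.symm

theorem mul_eq_zero_of_normalState_eq_zero (hK : IsDensityOperator K) {C : H →L[ℂ] H}
    (hC : normalState K (star C * C) = 0) : C * K = 0 := by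
  refine ContinuousLinearMap.ext fun x => ext_inner_left ℂ fun y => ?_
  have h := normalState_mul_eq_zero hK hC (rankOne ℂ x y)
  rw [mul_def, rankOne_comp, normalState_rankOne, adjoint_inner_left] at h
  simpa using h

theorem normalState_conj_unitary (hK : IsDensityOperator K) {U : H →L[ℂ] H}
    (hU : U ∈ unitary (H →L[ℂ] H)) (hUK : U * K = K * U) (A : H →L[ℂ] H) :
    normalState K (star U * A * U) = normalState K A := by
  let b : HilbertBasis _ ℂ H :=
    .ofRepr ((Unitary.linearIsometryEquiv ⟨U, hU⟩).symm.trans (traceBasis (H := H)).repr)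
  have hb : ∀ i, b i = U (traceBasis i) := fun _ => rfl
  refine (hasSum_inner_normalState hK traceBasis _).unique
    ((hasSum_inner_normalState hK b A).congr_fun fun i => ?_)
  have hUK' : K * star U = star U * K := by
    simpa [hK.isSelfAdjoint.star_eq] using congr_arg star hUK
  rw [hb, ← adjoint_inner_right, ← star_eq_adjoint]
  exact congr_arg _ (DFunLike.congr_fun hUK' (A (U (traceBasis i))))

theorem commute_of_normalState_conj {U : H →L[ℂ] H} (hU : U ∈ unitary (H →L[ℂ] H))
    (h : ∀ A, normalState K (star U * A * U) = normalState K A) : U * K = K * U := by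
  have hconj : U * K * star U = K := by
    refine ContinuousLinearMap.ext fun x => ext_inner_left ℂ fun y => ?_
    have hxy := h (rankOne ℂ x y)
    have hrank : star U * rankOne ℂ x y * U = rankOne ℂ (star U x) (star U y) := by
      ext z
      simp [star_eq_adjoint, adjoint_inner_left]
    rw [hrank, normalState_rankOne, normalState_rankOne] at hxy
    rw [← hxy, star_eq_adjoint, adjoint_inner_left]
    rfl
  rw [← mul_one (U * K), ← (Unitary.mem_iff.1 hU).1, ← mul_assoc, hconj]

end Trace

section Riesz

open MeasureTheory WeakDual CompactlySupported

section CompactSpace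

variable {X : Type*} [TopologicalSpace X] [CompactSpace X] [T2Space X] [MeasurableSpace X]
  [BorelSpace X]

theorem exists_isFiniteMeasure_eq_integral_of_real (Λ : C(X, ℝ) →ₚ[ℝ] ℝ) :
    ∃ μ : Measure X, IsFiniteMeasure μ ∧ ∀ f, Λ f = ∫ x, f x ∂μ := by
  let Λc : C_c(X, ℝ) →ₚ[ℝ] ℝ := PositiveLinearMap.mk₀
    { toFun := fun f => Λ f
      map_add' := fun f g => map_add Λ (f : C(X, ℝ)) g
      map_smul' := fun c f => map_smul Λ c (f : C(X, ℝ)) }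
    fun f hf => map_nonneg Λ (a := (f : C(X, ℝ))) hf
  exact ⟨RealRMK.rieszMeasure Λc, inferInstance, fun f => (RealRMK.integral_rieszMeasure Λc
    (CompactlySupportedContinuousMap.continuousMapEquiv f)).symm⟩

theorem exists_isFiniteMeasure_eq_integral (φ : C(X, ℂ) →ₚ[ℂ] ℂ) :
    ∃ μ : Measure X, IsFiniteMeasure μ ∧ ∀ f, φ f = ∫ x, f x ∂μ := by
  let ofReal := ContinuousMap.realToRCLikeStarAlgHom X ℂ
  let Λ : C(X, ℝ) →ₚ[ℝ] ℝ := PositiveLinearMap.mk₀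
    (Complex.reLm ∘ₗ φ.toLinearMap.restrictScalars ℝ ∘ₗ ofReal.toAlgHom.toLinearMap)
    fun f hf => (Complex.nonneg_iff.1 (map_nonneg φ (a := ofReal f) fun x =>
      Complex.zero_le_real.2 (hf x))).1
  obtain ⟨μ, hμ, hΛ⟩ := exists_isFiniteMeasure_eq_integral_of_real Λ
  have hreal (f : C(X, ℝ)) : φ (ofReal f) = ((∫ x, f x ∂μ : ℝ) : ℂ) := by
    rw [← hΛ]
    have h : IsSelfAdjoint (ofReal f) := ContinuousMap.isSelfAdjoint_realToRCLike ℂ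
    exact (Complex.conj_eq_iff_re.1 (h.map' φ)).symm
  refine ⟨μ, hμ, fun f => ?_⟩
  let re : C(X, ℝ) := ⟨fun x => (f x).re, by fun_prop⟩
  let im : C(X, ℝ) := ⟨fun x => (f x).im, by fun_prop⟩
  have hf : f = ofReal re + Complex.I • ofReal im := ContinuousMap.ext fun x =>
    (Complex.re_add_im (f x)).symm.trans (congr_arg _ (mul_comm _ _))
  have hint : Integrable f μ :=
    f.continuous.integrable_of_hasCompactSupport (.of_compactSpace _)
  calc φ f = ((∫ x, re x ∂μ : ℝ) : ℂ) + ((∫ x, im x ∂μ : ℝ) : ℂ) * Complex.I := by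
        rw [hf, map_add, map_smul, hreal, hreal, smul_eq_mul, mul_comm]
    _ = ∫ x, f x ∂μ := integral_re_add_im hint

end CompactSpace

variable {D : Type*} [CommCStarAlgebra D]

theorem exists_isProbabilityMeasure_characterSpace [MeasurableSpace (characterSpace ℂ D)]
    [BorelSpace (characterSpace ℂ D)] {φ : D →ₗ[ℂ] ℂ} (hφ : ∀ a, 0 ≤ φ (star a * a))
    (hφ1 : φ 1 = 1) :
    ∃ μ : Measure (characterSpace ℂ D), IsProbabilityMeasure μ ∧
      ∀ a, φ a = ∫ χ : characterSpace ℂ D, χ a ∂μ := by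
  let Γ := gelfandStarTransform D
  let ψ : C(characterSpace ℂ D, ℂ) →ₚ[ℂ] ℂ := PositiveLinearMap.mk₀
    (φ ∘ₗ Γ.symm.toAlgEquiv.toLinearMap) fun f hf => by
      obtain ⟨g, rfl⟩ := CStarAlgebra.nonneg_iff_eq_star_mul_self.1 hf
      simpa [map_star] using hφ (Γ.symm g)
  obtain ⟨μ, _, hψ⟩ := exists_isFiniteMeasure_eq_integral ψ
  have hφμ (a : D) : φ a = ∫ χ : characterSpace ℂ D, χ a ∂μ :=
    (congr_arg φ (Γ.symm_apply_apply a)).symm.trans (hψ (Γ a))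
  refine ⟨μ, ⟨?_⟩, hφμ⟩
  have h1 := hφμ 1
  simp only [hφ1, map_one, integral_const, Complex.real_smul, mul_one] at h1
  exact (ENNReal.toReal_eq_one_iff _).1 (by exact_mod_cast h1.symm)

end Riesz

section Quotient

open MeasureTheory WeakDual

variable {𝔄 D : Type*} [CStarAlgebra 𝔄] [CommCStarAlgebra D] {B : StarSubalgebra ℂ 𝔄}

/-- The dispersion-free state `χ ∘ γ` of `B`, for a character `χ` of a commutative C⋆-algebra `D`
and a continuous ⋆-homomorphism `γ` from `B` to `D`. -/
noncomputable def pullbackCharacter (γ : B →⋆ₐ[ℂ] D) (hγ : Continuous γ)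
    (χ : characterSpace ℂ D) : dispersionFreeStates B :=
  ⟨StrongDual.toWeakDual ((CharacterSpace.toCLM χ).comp ⟨γ.toAlgHom.toLinearMap, hγ⟩), by
    refine ⟨fun A => ?_, (congr_arg χ (map_one γ)).trans (map_one χ), fun A X =>
      (congr_arg χ (map_mul γ A X)).trans (map_mul χ _ _)⟩
    change 0 ≤ χ (γ (star A * A))
    rw [map_mul, map_star, map_mul, map_star]
    exact star_mul_self_nonneg _⟩

theorem continuous_pullbackCharacter (γ : B →⋆ₐ[ℂ] D) (hγ : Continuous γ) :
    Continuous (pullbackCharacter γ hγ) :=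
  Continuous.subtype_mk (WeakDual.continuous_of_continuous_eval fun A =>
    (WeakDual.eval_continuous (γ A)).comp continuous_subtype_val) _

theorem isBeable_of_starAlgHom {ρ : 𝔄 → ℂ} (γ : B →⋆ₐ[ℂ] D) (hγ : Continuous γ) {φ : D →ₗ[ℂ] ℂ}
    (hφ : ∀ a, 0 ≤ φ (star a * a)) (hφ1 : φ 1 = 1) (hρ : ∀ A : B, ρ A = φ (γ A)) :
    IsBeable ρ B := by
  let : MeasurableSpace (characterSpace ℂ D) := borel _
  have : BorelSpace (characterSpace ℂ D) := ⟨rfl⟩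
  have : BorelSpace (dispersionFreeStates B) := ⟨rfl⟩
  obtain ⟨μ, hμ, hφμ⟩ := exists_isProbabilityMeasure_characterSpace hφ hφ1
  have hψ := (continuous_pullbackCharacter γ hγ).measurable.aemeasurable (μ := μ)
  have heval (A : B) : Continuous fun ω : dispersionFreeStates B => (ω : WeakDual ℂ B) A :=
    (WeakDual.eval_continuous A).comp continuous_subtype_val
  refine ⟨μ.map (pullbackCharacter γ hγ), Measure.isProbabilityMeasure_map hψ, fun A => ?_⟩
  rw [integral_map hψ (heval A).measurable.aestronglyMeasurable, hρ, hφμ]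
  rfl

end Quotient

theorem submodule_le_of_isSelfAdjoint_mem {E : Type*} [AddCommGroup E] [StarAddMonoid E]
    [Module ℂ E] [StarModule ℂ E] {V W : Submodule ℂ E} (hV : ∀ x ∈ V, star x ∈ V)
    (h : ∀ x ∈ V, IsSelfAdjoint x → x ∈ W) : V ≤ W := fun x hx => by
  have hre : (realPart x : E) ∈ V := by
    rw [realPart_apply_coe, ← Complex.coe_smul]
    exact V.smul_mem _ (V.add_mem hx (hV x hx))
  have him : (imaginaryPart x : E) ∈ V := by
    rw [imaginaryPart_apply_coe, ← Complex.coe_smul]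
    exact V.smul_mem _ (V.smul_mem _ (V.sub_mem hx (hV x hx)))
  rw [← realPart_add_I_smul_imaginaryPart x]
  exact W.add_mem (h _ hre (realPart x).2) (W.smul_mem _ (h _ him (imaginaryPart x).2))

section Abelian

open NonUnitalStarAlgebra

variable {𝔄 : Type*} [NonUnitalRing 𝔄] [StarRing 𝔄] [Module ℂ 𝔄] [IsScalarTower ℂ 𝔄 𝔄]
  [SMulCommClass ℂ 𝔄 𝔄] [StarModule ℂ 𝔄]

/-- `N` is an abelian ⋆-subalgebra contained in `W`. The predicate `IsMaximalAbelianIn` is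
maximality for this property. -/
def IsAbelianIn (W : Set 𝔄) (N : NonUnitalStarSubalgebra ℂ 𝔄) : Prop :=
  (N : Set 𝔄) ⊆ W ∧ ∀ A ∈ N, ∀ B ∈ N, A * B = B * A

variable {C N M : NonUnitalStarSubalgebra ℂ 𝔄}

theorem isAbelianIn_adjoin {s : Set 𝔄} (hsC : s ⊆ C) (hstar : ∀ x ∈ s, star x ∈ s)
    (hcomm : ∀ x ∈ s, ∀ y ∈ s, x * y = y * x) : IsAbelianIn (C : Set 𝔄) (adjoin ℂ s) := by
  refine ⟨adjoin_le hsC, fun A hA B hB => ?_⟩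
  have := isMulCommutative_adjoin ℂ hcomm fun x hx y hy => hcomm x hx _ (hstar y hy)
  exact congr_arg Subtype.val (this.is_comm.comm ⟨A, hA⟩ ⟨B, hB⟩)

theorem IsAbelianIn.exists_le_maximal (hN : IsAbelianIn (C : Set 𝔄) N) :
    ∃ M, N ≤ M ∧ Maximal (IsAbelianIn (C : Set 𝔄)) M := by
  refine zorn_le_nonempty₀ {N | IsAbelianIn (C : Set 𝔄) N} (fun c hc hchain _ _ => ?_) N hN
  have hunion : IsAbelianIn (C : Set 𝔄) (adjoin ℂ (⋃ M ∈ c, (M : Set 𝔄))) := by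
    refine isAbelianIn_adjoin (Set.iUnion₂_subset fun M hM => (hc hM).1) ?_ ?_ <;>
      simp only [Set.mem_iUnion₂]
    · rintro x ⟨M, hM, hx⟩
      exact ⟨M, hM, star_mem hx⟩
    · rintro x ⟨M, hM, hx⟩ y ⟨N, hN, hy⟩
      rcases hchain.total hM hN with h | h
      · exact (hc hN).2 x (h hx) y hy
      · exact (hc hM).2 x hx y (h hy)
  refine ⟨_, hunion, fun M hM => ?_⟩
  exact (Set.subset_iUnion₂ (s := fun (M : NonUnitalStarSubalgebra ℂ 𝔄) (_ : M ∈ c) =>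
    (M : Set 𝔄)) M hM).trans (subset_adjoin ℂ _)

theorem isAbelianIn_adjoin_insert (hM : IsAbelianIn (C : Set 𝔄) M) {X : 𝔄} (hX : X ∈ C)
    (hXM : X ∈ (M : Set 𝔄).centralizer) (hXs : IsSelfAdjoint X) :
    IsAbelianIn (C : Set 𝔄) (adjoin ℂ (insert X (M : Set 𝔄))) := by
  refine isAbelianIn_adjoin (Set.insert_subset hX hM.1) ?_ ?_
  · rintro x (rfl | hx)
    · exact .inl hXs
    · exact .inr (star_mem hx)
  · rintro x (rfl | hx) y (rfl | hy)
    · rfl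
    · exact (hXM y hy).symm
    · exact hXM x hx
    · exact hM.2 x hx y hy

theorem mem_of_maximal_isAbelianIn (hM : Maximal (IsAbelianIn (C : Set 𝔄)) M) {X : 𝔄}
    (hX : X ∈ C) (hXM : X ∈ (M : Set 𝔄).centralizer) : X ∈ M := by
  let V : Submodule ℂ 𝔄 := C.toSubmodule ⊓ (NonUnitalSubalgebra.centralizer ℂ M).toSubmodule
  suffices hV : V ≤ M.toSubmodule from hV ⟨hX, hXM⟩
  refine submodule_le_of_isSelfAdjoint_mem (fun Y hY => ?_) fun Y hY hYs => ?_
  · exact ⟨star_mem (s := C) hY.1, Set.star_mem_centralizer' (fun A => star_mem (s := M)) hY.2⟩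
  · exact hM.le_of_ge (isAbelianIn_adjoin_insert hM.prop hY.1 hY.2 hYs)
      ((Set.subset_insert _ _).trans (subset_adjoin ℂ _))
      (subset_adjoin ℂ _ (Set.mem_insert _ _))

theorem isClosed_of_maximal_isAbelianIn [TopologicalSpace 𝔄] [T2Space 𝔄] [ContinuousMul 𝔄]
    (hC : IsClosed (C : Set 𝔄)) (hM : Maximal (IsAbelianIn (C : Set 𝔄)) M) :
    IsClosed (M : Set 𝔄) := by
  have h : (M : Set 𝔄) = (C : Set 𝔄) ∩ (M : Set 𝔄).centralizer := Set.Subset.antisymm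
    (fun X hX => ⟨hM.prop.1 hX, fun A hA => hM.prop.2 A hA X hX⟩)
    fun X hX => mem_of_maximal_isAbelianIn hM hX.1 hX.2
  rw [h]
  exact hC.inter (Set.isClosed_centralizer _)

end Abelian

section Reduced

section Ring

variable {𝔄 : Type*} [Ring 𝔄] {e A X : 𝔄}

theorem mul_mul_mul_eq_of_comm (he : IsIdempotentElem e) (hX : X * e = e * X) :
    A * e * (X * e) = A * X * e := by
  rw [mul_assoc A, ← mul_assoc e, ← hX, mul_assoc X, he.eq, mul_assoc]

theorem mul_eq_of_forall_mul_eq [StarRing 𝔄] (he : IsStarProjection e) {V : Set 𝔄}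
    (hV : ∀ A ∈ V, star A ∈ V) (hVe : ∀ A ∈ V, A * e = A) (hA : A ∈ V) : e * A = A := by
  simpa [he.isSelfAdjoint.star_eq] using congr_arg star (hVe _ (hV A hA))

end Ring

variable {𝔄 : Type*} [Ring 𝔄] [StarRing 𝔄] [Algebra ℂ 𝔄] [StarModule ℂ 𝔄] {e : 𝔄}

/-- The restriction `V e` of a ⋆-subalgebra `V` to the range of a projection `e` that commutes
with `V`. -/
def restriction (V : StarSubalgebra ℂ 𝔄) (he : IsStarProjection e)
    (heV : e ∈ (V : Set 𝔄).centralizer) : NonUnitalStarSubalgebra ℂ 𝔄 where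
  carrier := (fun A => A * e) '' V
  add_mem' := by
    rintro _ _ ⟨A, hA, rfl⟩ ⟨X, hX, rfl⟩
    exact ⟨A + X, add_mem hA hX, add_mul A X e⟩
  zero_mem' := ⟨0, zero_mem V, zero_mul e⟩
  mul_mem' := by
    rintro _ _ ⟨A, hA, rfl⟩ ⟨X, hX, rfl⟩
    exact ⟨A * X, mul_mem hA hX, (mul_mul_mul_eq_of_comm he.isIdempotentElem (heV X hX)).symm⟩
  smul_mem' := by
    rintro c _ ⟨A, hA, rfl⟩
    exact ⟨c • A, V.smul_mem hA c, smul_mul_assoc c A e⟩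
  star_mem' := by
    rintro _ ⟨A, hA, rfl⟩
    exact ⟨star A, star_mem hA, by
      rw [star_mul, he.isSelfAdjoint.star_eq]; exact heV _ (star_mem hA)⟩

theorem isClosed_restriction [TopologicalSpace 𝔄] [T2Space 𝔄] [ContinuousMul 𝔄]
    {V : StarSubalgebra ℂ 𝔄} (hV : IsClosed (V : Set 𝔄)) (he : IsStarProjection e)
    (heV : e ∈ (V : Set 𝔄).centralizer) (hemem : e ∈ V) :
    IsClosed (restriction V he heV : Set 𝔄) := by
  have h : (restriction V he heV : Set 𝔄) = (V : Set 𝔄) ∩ {X | X * e = X} := by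
    refine Set.Subset.antisymm ?_ fun X hX => ⟨X, hX⟩
    rintro _ ⟨A, hA, rfl⟩
    exact ⟨mul_mem hA hemem, (mul_assoc A e e).trans (congr_arg _ he.isIdempotentElem)⟩
  rw [h]
  exact hV.inter (isClosed_eq (continuous_mul_const e) continuous_id)

variable {M : NonUnitalStarSubalgebra ℂ 𝔄}

/-- The algebra `(1 - e) 𝔄 (1 - e) ⊕ M`, for a projection `e` that is a unit of `M`, given as the
algebra of the elements of `𝔄` that commute with `e` and whose restriction to `e` is in `M`. -/
def directSumAlgebra (he : IsStarProjection e) (heM : e ∈ M) : StarSubalgebra ℂ 𝔄 where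
  carrier := {X | X * e = e * X ∧ X * e ∈ M}
  mul_mem' := fun {X Y} ⟨hX, hXM⟩ ⟨hY, hYM⟩ => by
    refine ⟨Commute.mul_left hX hY, ?_⟩
    rw [← mul_mul_mul_eq_of_comm he.isIdempotentElem hY]
    exact mul_mem hXM hYM
  add_mem' := fun {X Y} ⟨hX, hXM⟩ ⟨hY, hYM⟩ =>
    ⟨Commute.add_left hX hY, by rw [add_mul]; exact add_mem hXM hYM⟩
  algebraMap_mem' := fun c => ⟨Algebra.commutes c e, by
    rw [← Algebra.smul_def]; exact M.smul_mem' c heM⟩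
  star_mem' := fun {X} ⟨hX, hXM⟩ => by
    have hstar : star X * e = e * star X := by
      simpa [he.isSelfAdjoint.star_eq] using (congr_arg star hX).symm
    refine ⟨hstar, ?_⟩
    rw [hstar, ← he.isSelfAdjoint.star_eq, ← star_mul]
    exact star_mem hXM

variable {he : IsStarProjection e} {heM : e ∈ M}

theorem mem_directSumAlgebra_of_mem (hMe : ∀ A ∈ M, A * e = A) {A : 𝔄} (hA : A ∈ M) :
    A ∈ directSumAlgebra he heM :=
  ⟨(hMe A hA).trans (mul_eq_of_forall_mul_eq he (fun _ => star_mem) hMe hA).symm, by rwa [hMe A hA]⟩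

theorem coe_directSumAlgebra (hMe : ∀ A ∈ M, A * e = A) :
    (directSumAlgebra he heM : Set 𝔄) =
      {X | ∃ C, ∃ A ∈ M, X = (1 - e) * C * (1 - e) + A} := by
  ext X
  constructor
  · rintro ⟨hX, hXM⟩
    refine ⟨X, X * e, hXM, ?_⟩
    have hee := he.isIdempotentElem.eq
    rw [mul_sub, mul_one, sub_mul, sub_mul, one_mul, mul_assoc _ X, hX, ← mul_assoc, hee]
    abel
  · rintro ⟨C, A, hA, rfl⟩
    refine add_mem (S := StarSubalgebra ℂ 𝔄) (s := directSumAlgebra he heM) ⟨?_, ?_⟩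
      (mem_directSumAlgebra_of_mem hMe hA)
    all_goals rw [mul_assoc _ _ e, he.one_sub_mul_self, mul_zero]
    · rw [← mul_assoc, ← mul_assoc, he.mul_one_sub_self, zero_mul, zero_mul]
    · exact zero_mem M

theorem isClosed_directSumAlgebra [TopologicalSpace 𝔄] [T2Space 𝔄] [ContinuousMul 𝔄]
    (hM : IsClosed (M : Set 𝔄)) : IsClosed (directSumAlgebra he heM : Set 𝔄) :=
  (isClosed_eq (continuous_mul_const e) (continuous_const_mul e)).inter
    (hM.preimage (continuous_mul_const e))

theorem conj_mem_directSumAlgebra {U X : 𝔄} (hU : U ∈ unitary 𝔄)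
    (hUM : U ∈ (M : Set 𝔄).centralizer) (hX : X ∈ directSumAlgebra he heM) :
    U * X * star U ∈ directSumAlgebra he heM := by
  have hUM' : star U ∈ (M : Set 𝔄).centralizer := Set.star_mem_centralizer' (fun A => star_mem) hUM
  refine ⟨((Commute.mul_left (hUM e heM).symm hX.1).mul_left (hUM' e heM).symm).eq, ?_⟩
  have h : U * X * star U * e = X * e := by
    rw [mul_assoc, ← hUM' e heM, mul_assoc U, ← mul_assoc X, hUM' _ hX.2, ← mul_assoc,
      (Unitary.mem_iff.1 hU).2, one_mul]
  rw [h]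
  exact hX.2

theorem image_conj_directSumAlgebra {U : 𝔄} (hU : U ∈ unitary 𝔄)
    (hUM : U ∈ (M : Set 𝔄).centralizer) :
    (fun X => U * X * star U) '' (directSumAlgebra he heM : Set 𝔄) = directSumAlgebra he heM := by
  refine Set.Subset.antisymm (Set.image_subset_iff.2 fun X =>
    conj_mem_directSumAlgebra hU hUM) fun X hX => ?_
  have hUM' : star U ∈ (M : Set 𝔄).centralizer := Set.star_mem_centralizer' (fun A => star_mem) hUM
  refine ⟨star U * X * star (star U), conj_mem_directSumAlgebra (Unitary.star_mem hU) hUM' hX, ?_⟩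
  simp only [star_star, ← mul_assoc, (Unitary.mem_iff.1 hU).2, one_mul]
  rw [mul_assoc, (Unitary.mem_iff.1 hU).2, mul_one]

end Reduced

section Beable

variable {𝔄 : Type*} [CStarAlgebra 𝔄] {e : 𝔄} {M : NonUnitalStarSubalgebra ℂ 𝔄}

/-- A commutative closed ⋆-subalgebra `M` with unit `e`, as a normed ring. -/
noncomputable abbrev normedCommRingOfUnit (hcomm : ∀ A ∈ M, ∀ B ∈ M, A * B = B * A) (heM : e ∈ M)
    (hMe : ∀ A ∈ M, A * e = A) : NormedCommRing M :=
  { (inferInstance : NonUnitalNormedRing M) with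
    one := ⟨e, heM⟩
    one_mul A := Subtype.ext ((hcomm e heM A A.2).trans (hMe A A.2))
    mul_one A := Subtype.ext (hMe A A.2)
    mul_comm A B := Subtype.ext (hcomm A A.2 B B.2) }

/-- A closed commutative ⋆-subalgebra with unit `e` is a commutative C⋆-algebra. -/
noncomputable abbrev commCStarAlgebraOfUnit (hM : IsClosed (M : Set 𝔄))
    (hcomm : ∀ A ∈ M, ∀ B ∈ M, A * B = B * A) (heM : e ∈ M) (hMe : ∀ A ∈ M, A * e = A) :
    CommCStarAlgebra M :=
  have : IsClosed (M : Set 𝔄) := hM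
  letI := normedCommRingOfUnit hcomm heM hMe
  letI alg : Algebra ℂ M := Algebra.ofModule smul_mul_assoc mul_smul_comm
  { normedCommRingOfUnit hcomm heM hMe, (inferInstance : NonUnitalCStarAlgebra M), alg with }

theorem isBeable_directSumAlgebra {ρ : 𝔄 →ₗ[ℂ] ℂ} (hpos : ∀ A, 0 ≤ ρ (star A * A))
    (hone : ρ 1 = 1) (hρe : ∀ A, ρ (A * e) = ρ A) {he : IsStarProjection e} {heM : e ∈ M}
    (hM : IsClosed (M : Set 𝔄)) (hcomm : ∀ A ∈ M, ∀ B ∈ M, A * B = B * A)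
    (hMe : ∀ A ∈ M, A * e = A) : IsBeable ρ (directSumAlgebra he heM) := by
  let := commCStarAlgebraOfUnit hM hcomm heM hMe
  let γ : directSumAlgebra he heM →⋆ₐ[ℂ] M :=
    { toFun X := ⟨X * e, X.2.2⟩
      map_one' := Subtype.ext (one_mul e)
      map_mul' X Y := Subtype.ext (mul_mul_mul_eq_of_comm he.isIdempotentElem Y.2.1).symm
      map_zero' := Subtype.ext (zero_mul e)
      map_add' X Y := Subtype.ext (add_mul _ _ e)
      commutes' c := Subtype.ext (Algebra.smul_def c e).symm
      map_star' X := Subtype.ext <| by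
        simpa [he.isSelfAdjoint.star_eq] using (star_mem X.2).1 }
  refine isBeable_of_starAlgHom γ ?_ (φ := ρ ∘ₗ M.toNonUnitalSubalgebra.toSubmodule.subtype)
    (fun A => hpos A) ?_ fun A => (hρe A).symm
  · exact (continuous_subtype_val.mul_const e).subtype_mk _
  · exact (one_mul e ▸ hρe 1).trans hone

end Beable

section Commutant

theorem commute_commutator_of_forall_commute_exp_conj {𝔸 : Type*} [NormedRing 𝔸]
    [NormedAlgebra ℝ 𝔸] [CompleteSpace 𝔸] {a x : 𝔸}
    (h : ∀ t : ℝ, Commute a (NormedSpace.exp (t • x) * a * NormedSpace.exp (t • -x))) :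
    Commute a (a * x - x * a) := by
  let : NormedAlgebra ℚ 𝔸 := NormedAlgebra.restrictScalars ℚ ℝ 𝔸
  have hconj := ((hasDerivAt_exp_smul_const (𝕂 := ℝ) x 0).mul_const a).mul
    (hasDerivAt_exp_smul_const (𝕂 := ℝ) (-x) 0)
  have hbracket := (hconj.const_mul a).sub (hconj.mul_const a)
  have hzero := hbracket.unique ((hasDerivAt_const (0 : ℝ) (0 : 𝔸)).congr_of_eventuallyEq
    (.of_forall fun t => sub_eq_zero.2 (h t).eq))
  simp only [zero_smul, NormedSpace.exp_zero, one_mul, mul_one] at hzero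
  refine (sub_eq_zero.1 (Eq.trans ?_ hzero)).symm
  noncomm_ring

variable {𝔄 : Type*} [CStarAlgebra 𝔄] {a x : 𝔄}

/- If `δ` is the derivation `[a, ·]`, then `δ² x = 0` gives `δ² (x²) = 2 (δ x)²`, while `δ x` is
skew-adjoint. -/
theorem commute_of_commute_commutator (ha : IsSelfAdjoint a) (hx : IsSelfAdjoint x)
    (h : Commute a (a * x - x * a)) (h' : Commute a (a * (x * x) - x * x * a)) : Commute a x := by
  set d := a * x - x * a with hd
  have hdd : (2 : ℂ) • (d * d) = 0 := by
    have hδ : a * (a * (x * x) - x * x * a) - (a * (x * x) - x * x * a) * a =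
        (a * d - d * a) * x + (d * d + d * d) + x * (a * d - d * a) := by
      rw [hd]; noncomm_ring
    rw [sub_eq_zero.2 h'.eq, sub_eq_zero.2 h.eq] at hδ
    simpa [two_smul] using hδ.symm
  have hstar : star d = -d := by
    rw [hd, star_sub, star_mul, star_mul, ha.star_eq, hx.star_eq]; abel
  have hd0 : d = 0 := by
    rw [← CStarRing.star_mul_self_eq_zero_iff, hstar, neg_mul, neg_eq_zero]
    exact (smul_eq_zero.1 hdd).resolve_left two_ne_zero
  exact sub_eq_zero.1 hd0

variable {F : Set 𝔄}

theorem commute_commutator_of_commute_conj_unitary (hx : IsSelfAdjoint x)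
    (hxF : x ∈ F.centralizer)
    (h : ∀ U ∈ unitary 𝔄, U ∈ F.centralizer → Commute a (U * a * star U)) :
    Commute a (a * x - x * a) := by
  let : NormedAlgebra ℚ 𝔄 := NormedAlgebra.restrictScalars ℚ ℂ 𝔄
  have hIx : star (Complex.I • x) = -(Complex.I • x) := by simp [hx.star_eq]
  have hcomm : Commute a (a * (Complex.I • x) - (Complex.I • x) * a) := by
    refine commute_commutator_of_forall_commute_exp_conj fun t => ?_
    have hskew : t • Complex.I • x ∈ skewAdjoint 𝔄 := by
      rw [skewAdjoint.mem_iff, star_smul, hIx, smul_neg, star_trivial]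
    have hexp : NormedSpace.exp (t • -(Complex.I • x)) =
        star (NormedSpace.exp (t • Complex.I • x)) := by
      rw [NormedSpace.star_exp, star_smul, hIx, star_trivial]
    rw [hexp]
    exact h _ (NormedSpace.exp_mem_unitary_of_mem_skewAdjoint hskew) fun A hA =>
      (((show Commute A x from hxF A hA).smul_right _).smul_right t).exp_right.eq
  rw [mul_smul_comm, smul_mul_assoc, ← smul_sub] at hcomm
  exact (Commute.smul_right_iff₀ Complex.I_ne_zero).1 hcomm

theorem mem_centralizer_centralizer_of_commute_conj (hF : ∀ A ∈ F, star A ∈ F)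
    (ha : IsSelfAdjoint a)
    (h : ∀ U ∈ unitary 𝔄, U ∈ F.centralizer → Commute a (U * a * star U)) :
    a ∈ F.centralizer.centralizer := by
  have hle : (Subalgebra.centralizer ℂ F).toSubmodule ≤
      (Subalgebra.centralizer ℂ {a}).toSubmodule := by
    refine submodule_le_of_isSelfAdjoint_mem (fun X hX => Set.star_mem_centralizer' hF hX)
      fun X hX hXs => Subalgebra.mem_centralizer_iff ℂ |>.2 ?_
    rintro _ rfl
    have hXX : IsSelfAdjoint (X * X) := by rw [isSelfAdjoint_iff, star_mul, hXs.star_eq]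
    exact commute_of_commute_commutator ha hXs
      (commute_commutator_of_commute_conj_unitary hXs hX h)
      (commute_commutator_of_commute_conj_unitary hXX (Set.mul_mem_centralizer hX hX) h)
  exact fun X hX => (hle hX a rfl).symm

end Commutant

theorem starProjection_mem_centralizer {𝕜 E : Type*} [RCLike 𝕜] [NormedAddCommGroup E]
    [InnerProductSpace 𝕜 E] [CompleteSpace E] {F : Set (E →L[𝕜] E)} (hF : ∀ A ∈ F, star A ∈ F)
    {Y : Submodule 𝕜 E} [Y.HasOrthogonalProjection] (hY : ∀ A ∈ F, ∀ y ∈ Y, A y ∈ Y) :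
    Y.starProjection ∈ F.centralizer := fun A hA => by
  refine ((ContinuousLinearMap.IsIdempotentElem.commute_iff
    (Submodule.isIdempotentElem_starProjection Y)).2 ⟨?_, ?_⟩).symm.eq
  · rw [Submodule.range_starProjection]
    exact hY A hA
  · rw [Submodule.ker_starProjection]
    exact ContinuousLinearMap.orthogonal_mem_invtSubmodule (hY (star A) (hF A hA))

section VonNeumann

variable {H : Type*} [NormedAddCommGroup H] [InnerProductSpace ℂ H] [CompleteSpace H]
  {F : Set (H →L[ℂ] H)}

/-- The smallest von Neumann algebra containing `F`, as the double commutant of `F ∪ star F`. -/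
noncomputable def vNAlgebra (F : Set (H →L[ℂ] H)) : VonNeumannAlgebra H where
  toStarSubalgebra :=
    StarSubalgebra.centralizer ℂ (StarSubalgebra.centralizer ℂ F : Set (H →L[ℂ] H))
  centralizer_centralizer' := by
    change Set.centralizer (Set.centralizer (SetLike.coe (StarSubalgebra.centralizer ℂ _))) =
      SetLike.coe (StarSubalgebra.centralizer ℂ _)
    rw [StarSubalgebra.coe_centralizer_centralizer, Set.centralizer_centralizer_centralizer]

theorem coe_vNAlgebra_eq_centralizer_centralizer (F : Set (H →L[ℂ] H)) :
    (vNAlgebra F : Set (H →L[ℂ] H)) = (F ∪ star F).centralizer.centralizer :=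
  StarSubalgebra.coe_centralizer_centralizer ℂ F

theorem coe_vNAlgebra (F : Set (H →L[ℂ] H)) : (vNAlgebra F : Set (H →L[ℂ] H)) = vN F := by
  refine Set.Subset.antisymm (Set.subset_iInter₂ fun V hV => ?_) (Set.iInter₂_subset _ ?_)
  · have hstar : star F ⊆ V := fun A hA => by simpa using star_mem (hV (Set.mem_star.1 hA))
    rw [coe_vNAlgebra_eq_centralizer_centralizer, ← V.centralizer_centralizer]
    exact Set.centralizer_subset (Set.centralizer_subset (Set.union_subset hV hstar))
  · rw [Set.mem_ofPred_eq, coe_vNAlgebra_eq_centralizer_centralizer]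
    exact Set.subset_union_left.trans Set.subset_centralizer_centralizer

theorem vN_eq_centralizer_centralizer (hF : ∀ A ∈ F, star A ∈ F) :
    vN F = F.centralizer.centralizer := by
  have hstar : star F ⊆ F := fun A hA => by simpa using hF _ (Set.mem_star.1 hA)
  rw [← coe_vNAlgebra, coe_vNAlgebra_eq_centralizer_centralizer,
    Set.union_eq_self_of_subset_right hstar]

end VonNeumann

section PrivSubspace

variable {H : Type*} [NormedAddCommGroup H] [InnerProductSpace ℂ H]
  {R : Set (H →L[ℂ] H)} {K T : H →L[ℂ] H}

theorem apply_mem_privSubspace {A : H →L[ℂ] H} (hA : A ∈ R.centralizer.centralizer) {x : H}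
    (hx : x ∈ closure (Set.range K)) : A x ∈ privSubspace R K :=
  Submodule.le_topologicalClosure _ (Submodule.subset_span ⟨A, hA, x, hx, rfl⟩)

theorem apply_mem_privSubspace_of_forall (hT : ∀ A ∈ R.centralizer.centralizer,
    ∀ x ∈ closure (Set.range K), T (A x) ∈ privSubspace R K) {y : H} (hy : y ∈ privSubspace R K) :
    T y ∈ privSubspace R K := by
  have hle : privSubspace R K ≤ (privSubspace R K).comap (T : H →ₗ[ℂ] H) := by
    refine Submodule.topologicalClosure_minimal _ (Submodule.span_le.2 ?_)
      ((Submodule.isClosed_topologicalClosure _).preimage T.continuous)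
    rintro _ ⟨A, hA, x, hx, rfl⟩
    exact hT A hA x hx
  exact hle hy

theorem apply_mem_privSubspace_of_mem (hT : T ∈ R) {y : H} (hy : y ∈ privSubspace R K) :
    T y ∈ privSubspace R K :=
  apply_mem_privSubspace_of_forall (fun _ hA _ hx => apply_mem_privSubspace
    (Set.mul_mem_centralizer (Set.subset_centralizer_centralizer hT) hA) hx) hy

theorem apply_mem_privSubspace_of_mem_centralizer (hT : T ∈ (insert K R).centralizer) {y : H}
    (hy : y ∈ privSubspace R K) : T y ∈ privSubspace R K := by
  refine apply_mem_privSubspace_of_forall (fun A hA x hx => ?_) hy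
  have hTA : T * A = A * T := hA T (Set.centralizer_subset (Set.subset_insert K R) hT)
  have hTK : K * T = T * K := hT K (Set.mem_insert K R)
  have hTx : T x ∈ closure (Set.range K) := by
    refine map_mem_closure T.continuous hx ?_
    rintro _ ⟨z, rfl⟩
    exact ⟨T z, DFunLike.congr_fun hTK z⟩
  exact DFunLike.congr_fun hTA x ▸ apply_mem_privSubspace hA hTx

theorem range_subset_privSubspace : Set.range K ⊆ privSubspace R K := fun x hx => by
  simpa using apply_mem_privSubspace (R := R) Set.one_mem_centralizer (subset_closure hx)

variable [CompleteSpace H]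

theorem privSubspace_le (hR : ∀ A ∈ R, star A ∈ R) {Y : Submodule ℂ H}
    (hY : IsClosed (Y : Set H)) (hKY : Set.range K ⊆ Y) (hRY : ∀ A ∈ R, ∀ y ∈ Y, A y ∈ Y) :
    privSubspace R K ≤ Y := by
  refine Submodule.topologicalClosure_minimal _ (Submodule.span_le.2 ?_) hY
  rintro _ ⟨A, hA, x, hx, rfl⟩
  have : CompleteSpace Y := hY.completeSpace_coe
  have hcomm := DFunLike.congr_fun (hA _ (starProjection_mem_centralizer hR hRY)) x
  refine Submodule.starProjection_eq_self_iff.1 (hcomm.trans (congr_arg A ?_))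
  exact Submodule.starProjection_eq_self_iff.2 (closure_minimal hKY hY hx)

theorem isLeast_privSubspace (hR : ∀ A ∈ R, star A ∈ R) :
    IsLeast {Y : Submodule ℂ H | IsClosed (Y : Set H) ∧ Set.range K ⊆ Y ∧
      ∀ A ∈ R, ∀ y ∈ Y, A y ∈ Y} (privSubspace R K) :=
  ⟨⟨Submodule.isClosed_topologicalClosure _, range_subset_privSubspace,
    fun _ hA _ hy => apply_mem_privSubspace_of_mem hA hy⟩,
    fun _ hY => privSubspace_le hR hY.1 hY.2.1 hY.2.2⟩

theorem isStarProjection_privProj : IsStarProjection (privProj R K) :=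
  isStarProjection_starProjection

theorem privProj_mul : privProj R K * K = K :=
  ContinuousLinearMap.ext fun x => Submodule.starProjection_eq_self_iff.2
    (range_subset_privSubspace ⟨x, rfl⟩)

theorem mul_privProj (hK : IsSelfAdjoint K) : K * privProj R K = K := by
  simpa [(isStarProjection_privProj (R := R) (K := K)).isSelfAdjoint.star_eq, hK.star_eq] using
    congr_arg star (privProj_mul (R := R) (K := K))

theorem star_mem_insert (hR : ∀ A ∈ R, star A ∈ R) (hK : IsSelfAdjoint K) :
    ∀ A ∈ insert K R, star A ∈ insert K R :=
  Set.forall_mem_insert.2 ⟨hK.star_eq.symm ▸ Set.mem_insert K R,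
    fun A hA => Set.mem_insert_of_mem K (hR A hA)⟩

theorem privProj_mem_centralizer (hR : ∀ A ∈ R, star A ∈ R) (hK : IsSelfAdjoint K) :
    privProj R K ∈ (insert K R).centralizer := by
  refine starProjection_mem_centralizer (star_mem_insert hR hK)
    (Set.forall_mem_insert.2 ⟨fun y _ => range_subset_privSubspace ⟨y, rfl⟩, ?_⟩)
  exact fun A hA y => apply_mem_privSubspace_of_mem hA

theorem privProj_mem_centralizer_centralizer (hR : ∀ A ∈ R, star A ∈ R) (hK : IsSelfAdjoint K) :
    privProj R K ∈ (insert K R).centralizer.centralizer :=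
  starProjection_mem_centralizer
    (fun _ hT => Set.star_mem_centralizer' (star_mem_insert hR hK) hT)
    fun _ hT _ => apply_mem_privSubspace_of_mem_centralizer hT

theorem mul_privProj_eq_zero {σ : Type*} [SetLike σ (H →L[ℂ] H)] [SubmonoidClass σ (H →L[ℂ] H)]
    {V : σ} (hR : ∀ A ∈ R, star A ∈ R) (hRV : R ⊆ V) (hT : ∀ A ∈ V, T * A * K = 0) :
    T * privProj R K = 0 := by
  let Z : Submodule ℂ H := ⨅ A ∈ V, (T * A).ker
  have hZ : ∀ z, z ∈ Z ↔ ∀ A ∈ V, (T * A) z = 0 := fun z => by simp [Z]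
  have hle : privSubspace R K ≤ Z := by
    refine privSubspace_le hR ?_ ?_ fun A hA y hy => (hZ _).2 fun X hX =>
      (hZ y).1 hy (X * A) (mul_mem hX (hRV hA))
    · simp only [Z, Submodule.coe_iInf]
      exact isClosed_biInter fun A _ => (T * A).isClosed_ker
    · rintro _ ⟨x, rfl⟩
      exact (hZ _).2 fun A hA => DFunLike.congr_fun (hT A hA) x
  refine ContinuousLinearMap.ext fun x => ?_
  simpa [privProj] using (hZ _).1 (hle (Submodule.starProjection_apply_mem _ x)) 1 (one_mem V)

end PrivSubspace

section Reduction

variable {𝔄 : Type*} [CStarAlgebra 𝔄] {e : 𝔄} {F : Set 𝔄} {B : StarSubalgebra ℂ 𝔄}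

theorem IsBeable.map_mul_commutator_mul_eq_zero {ρ : 𝔄 → ℂ} (hB : IsBeable ρ B) (A X Y Z : B) :
    ρ (Y * (A * X - X * A) * Z) = 0 := by
  obtain ⟨μ, -, hμ⟩ := hB
  refine (hμ (Y * (A * X - X * A) * Z)).trans (MeasureTheory.integral_eq_zero_of_ae
    (.of_forall fun ω => ?_))
  obtain ⟨ω, -, -, hω⟩ := ω
  change ω (Y * (A * X - X * A) * Z) = 0
  rw [hω, hω Y, map_sub, hω, hω X, mul_comm (ω X), sub_self, mul_zero, zero_mul]

theorem add_smul_one_sub_mem_unitary (he : IsStarProjection e) {z : ℂ} (hz : z ∈ unitary ℂ) :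
    e + z • (1 - e) ∈ unitary 𝔄 := by
  have hstar : star (e + z • (1 - e)) = e + star z • (1 - e) := by
    rw [star_add, star_smul, he.isSelfAdjoint.star_eq, he.one_sub.isSelfAdjoint.star_eq]
  rw [Unitary.mem_iff, hstar]
  simp only [mul_add, add_mul, smul_mul_assoc, mul_smul_comm, he.isIdempotentElem.eq,
    he.one_sub.isIdempotentElem.eq, he.mul_one_sub_self, he.one_sub_mul_self, smul_smul, smul_zero,
    add_zero, zero_add, Unitary.star_mul_self_of_mem hz, Unitary.mul_star_self_of_mem hz, one_smul,
    add_sub_cancel, and_self]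

/- With `u z = e + z (1 - e)`, the average of `z • u z * A * star (u z)` over the fourth roots of
unity `z` is `e * A * (1 - e)`. -/
theorem mul_mul_one_sub_mem (he : IsStarProjection e) {V : Submodule ℂ 𝔄} {A : 𝔄}
    (hA : ∀ z ∈ unitary ℂ, (e + z • (1 - e)) * A * star (e + z • (1 - e)) ∈ V) :
    e * A * (1 - e) ∈ V := by
  have hroots : ∀ k : ℕ, Complex.I ^ k ∈ unitary ℂ := fun k =>
    pow_mem (by simp [Unitary.mem_iff]) k
  have havg : (4 : ℂ) • (e * A * (1 - e)) = ∑ k ∈ Finset.range 4, Complex.I ^ k •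
      ((e + Complex.I ^ k • (1 - e)) * A * star (e + Complex.I ^ k • (1 - e))) := by
    simp only [star_add, star_smul, he.isSelfAdjoint.star_eq, he.one_sub.isSelfAdjoint.star_eq,
      star_pow, RCLike.star_def, Complex.conj_I, Finset.sum_range_succ, Finset.sum_range_zero,
      mul_add, add_mul, smul_mul_assoc, mul_smul_comm]
    generalize e * A * (1 - e) = X
    match_scalars <;> norm_num [pow_succ]
  have hmem : (4 : ℂ) • (e * A * (1 - e)) ∈ V :=
    havg ▸ V.sum_mem fun k _ => V.smul_mem _ (hA _ (hroots k))
  exact (V.smul_mem_iff four_ne_zero).1 hmem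

theorem mul_mul_one_sub_eq_zero (he : IsStarProjection e) (heF : e ∈ F.centralizer)
    (hBe : ∀ A ∈ B, ∀ X ∈ B, (A * X - X * A) * e = 0)
    (hBF : ∀ U ∈ unitary 𝔄, U ∈ F.centralizer → ∀ A ∈ B, U * A * star U ∈ B) {A : 𝔄} (hA : A ∈ B) :
    e * A * (1 - e) = 0 := by
  obtain ⟨T, hT⟩ : ∃ T, T = e * A * (1 - e) := ⟨_, rfl⟩
  rw [← hT]
  have hTB : T ∈ B := hT ▸ mul_mul_one_sub_mem he (V := B.toSubalgebra.toSubmodule) fun z hz =>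
    hBF _ (add_smul_one_sub_mem_unitary he hz) (Set.add_mem_centralizer heF fun X hX =>
      ((Commute.sub_right (Commute.one_right X) (heF X hX)).smul_right z).eq) A hA
  have hTe : T * e = 0 := by rw [hT, mul_assoc, he.one_sub_mul_self, mul_zero]
  have hstarTe : star T * e = star T := by
    rw [hT, mul_assoc, star_mul, he.isSelfAdjoint.star_eq, mul_assoc, he.isIdempotentElem.eq]
  have hcomm := hBe T hTB (star T) (star_mem hTB)
  rw [sub_mul, mul_assoc, mul_assoc, hstarTe, hTe, mul_zero, sub_zero] at hcomm
  exact (CStarRing.mul_star_self_eq_zero_iff T).1 hcomm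

theorem mem_centralizer_of_commutator_mul_eq_zero (he : IsStarProjection e)
    (heF : e ∈ F.centralizer) (hBe : ∀ A ∈ B, ∀ X ∈ B, (A * X - X * A) * e = 0)
    (hBF : ∀ U ∈ unitary 𝔄, U ∈ F.centralizer → ∀ A ∈ B, U * A * star U ∈ B) :
    e ∈ (B : Set 𝔄).centralizer := by
  intro A hA
  have hright := mul_mul_one_sub_eq_zero he heF hBe hBF hA
  have hleft : (1 - e) * A * e = 0 := by
    simpa [he.isSelfAdjoint.star_eq, mul_assoc] using
      congr_arg star (mul_mul_one_sub_eq_zero he heF hBe hBF (star_mem hA))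
  rw [mul_sub, mul_one, sub_eq_zero] at hright
  rw [sub_mul, one_mul, sub_mul, sub_eq_zero] at hleft
  exact hleft.trans hright.symm

theorem mul_mem_centralizer_centralizer_of_commutator_mul_eq_zero (he : IsStarProjection e)
    (hF : ∀ A ∈ F, star A ∈ F) (heF : e ∈ F.centralizer) (heF' : e ∈ F.centralizer.centralizer)
    (hBe : ∀ A ∈ B, ∀ X ∈ B, (A * X - X * A) * e = 0)
    (hBF : ∀ U ∈ unitary 𝔄, U ∈ F.centralizer → ∀ A ∈ B, U * A * star U ∈ B) {A : 𝔄} (hA : A ∈ B) :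
    A * e ∈ F.centralizer.centralizer := by
  have heB := mem_centralizer_of_commutator_mul_eq_zero he heF hBe hBF
  refine submodule_le_of_isSelfAdjoint_mem (V := B.toSubalgebra.toSubmodule)
    (W := (Subalgebra.centralizer ℂ F.centralizer).toSubmodule.comap (LinearMap.mulRight ℂ e))
    (fun X hX => star_mem (S := StarSubalgebra ℂ 𝔄) hX) (fun X hX hXs => ?_) hA
  refine mem_centralizer_centralizer_of_commute_conj (a := X * e) hF ?_ fun U hU hUF => ?_
  · rw [isSelfAdjoint_iff, star_mul, hXs.star_eq, he.isSelfAdjoint.star_eq, heB X hX]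
  · have hY : U * X * star U ∈ B := hBF U hU hUF X hX
    have hconj : U * (X * e) * star U = U * X * star U * e := by
      rw [mul_assoc _ (star U), heF' _ (Set.star_mem_centralizer' hF hUF)]
      simp only [mul_assoc]
    have hcomm := hBe X hX _ hY
    rw [sub_mul, sub_eq_zero] at hcomm
    rw [Commute, SemiconjBy, hconj, mul_mul_mul_eq_of_comm he.isIdempotentElem (heB _ hY), hcomm,
      mul_mul_mul_eq_of_comm he.isIdempotentElem (heB X hX)]

end Reduction

section Classification

variable {H : Type*} [NormedAddCommGroup H] [InnerProductSpace ℂ H] [CompleteSpace H]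
  {R : Set (H →L[ℂ] H)} {K : H →L[ℂ] H} {M : NonUnitalStarSubalgebra ℂ (H →L[ℂ] H)}
  {B : StarSubalgebra ℂ (H →L[ℂ] H)}

theorem coe_vNAlgebra_insert (hR : ∀ A ∈ R, star A ∈ R) (hK : IsSelfAdjoint K) :
    (vNAlgebra (insert K R) : Set (H →L[ℂ] H)) = (insert K R).centralizer.centralizer := by
  rw [coe_vNAlgebra, vN_eq_centralizer_centralizer (star_mem_insert hR hK)]

theorem privProj_mem_centralizer_vNAlgebra (hR : ∀ A ∈ R, star A ∈ R) (hK : IsSelfAdjoint K) :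
    privProj R K ∈
      ((vNAlgebra (insert K R)).toStarSubalgebra : Set (H →L[ℂ] H)).centralizer := by
  change privProj R K ∈ (vNAlgebra (insert K R) : Set (H →L[ℂ] H)).centralizer
  rw [coe_vNAlgebra_insert hR hK, Set.centralizer_centralizer_centralizer]
  exact privProj_mem_centralizer hR hK

/-- The algebra `vN(R, K) P_S`, as a ⋆-algebra of operators on `H`. -/
noncomputable def vNRestriction (hR : ∀ A ∈ R, star A ∈ R) (hK : IsSelfAdjoint K) :
    NonUnitalStarSubalgebra ℂ (H →L[ℂ] H) :=
  restriction (vNAlgebra (insert K R)).toStarSubalgebra isStarProjection_privProj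
    (privProj_mem_centralizer_vNAlgebra hR hK)

theorem coe_vNRestriction (hR : ∀ A ∈ R, star A ∈ R) (hK : IsSelfAdjoint K) :
    (vNRestriction hR hK : Set (H →L[ℂ] H)) = (fun A => A * privProj R K) '' vN (insert K R) :=
  congr_arg (fun V => (fun A => A * privProj R K) '' V) (coe_vNAlgebra (insert K R))

theorem vNRestriction_subset (hR : ∀ A ∈ R, star A ∈ R) (hK : IsSelfAdjoint K) :
    (vNRestriction hR hK : Set (H →L[ℂ] H)) ⊆ (insert K R).centralizer.centralizer := by
  rintro _ ⟨A, hA, rfl⟩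
  exact Set.mul_mem_centralizer (coe_vNAlgebra_insert hR hK ▸ hA)
    (privProj_mem_centralizer_centralizer hR hK)

theorem isClosed_vNRestriction (hR : ∀ A ∈ R, star A ∈ R) (hK : IsSelfAdjoint K) :
    IsClosed (vNRestriction hR hK : Set (H →L[ℂ] H)) := by
  have hcoe := coe_vNAlgebra_insert hR hK
  have hclosed : IsClosed (vNAlgebra (insert K R) : Set (H →L[ℂ] H)) :=
    hcoe ▸ Set.isClosed_centralizer _
  have hmem : privProj R K ∈ (vNAlgebra (insert K R) : Set (H →L[ℂ] H)) :=
    hcoe ▸ privProj_mem_centralizer_centralizer hR hK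
  exact isClosed_restriction hclosed isStarProjection_privProj _ hmem

theorem isMaximalAbelianIn_iff (hR : ∀ A ∈ R, star A ∈ R) (hK : IsSelfAdjoint K) :
    IsMaximalAbelianIn ((fun A => A * privProj R K) '' vN (insert K R)) M ↔
      Maximal (IsAbelianIn (vNRestriction hR hK : Set (H →L[ℂ] H))) M := by
  rw [coe_vNRestriction]
  rfl

theorem mul_privProj_of_subset_restriction (h : (M : Set (H →L[ℂ] H)) ⊆
    (fun A => A * privProj R K) '' vN (insert K R)) : ∀ A ∈ M, A * privProj R K = A := by
  intro A hA
  obtain ⟨X, -, rfl⟩ := h hA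
  exact (mul_assoc X _ _).trans (congr_arg _ isStarProjection_privProj.isIdempotentElem)

theorem IsAdmissible.privProj_mem (hM : IsAdmissible R K M) : privProj R K ∈ M :=
  hM.lower ⟨1, Set.mem_iInter₂.2 fun V _ => one_mem V, one_mul _⟩

protected theorem IsAdmissible.coe_directSumAlgebra (hM : IsAdmissible R K M) :
    (directSumAlgebra isStarProjection_privProj hM.privProj_mem : Set (H →L[ℂ] H)) =
      directSum R K M :=
  coe_directSumAlgebra (mul_privProj_of_subset_restriction hM.upper)

theorem normalState_mul_privProj (hK : IsDensityOperator K) (A : H →L[ℂ] H) :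
    normalState K (A * privProj R K) = normalState K A := by
  have he := (isStarProjection_privProj (R := R) (K := K)).one_sub
  have hzero : normalState K (star (1 - privProj R K) * (1 - privProj R K)) = 0 := by
    rw [he.isSelfAdjoint.star_eq, he.isIdempotentElem, normalState, mul_sub, mul_one,
      mul_privProj hK.isSelfAdjoint, sub_self]
    simp [trace]
  have h : normalStateLinearMap hK (A - A * privProj R K) = 0 :=
    (congr_arg _ (mul_one_sub A _).symm).trans (normalState_mul_eq_zero hK hzero A)
  exact (sub_eq_zero.1 ((map_sub _ _ _).symm.trans h)).symm

theorem isRBeable_directSumAlgebra (hR : ∀ A ∈ R, star A ∈ R) (hK : IsDensityOperator K)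
    (hM : IsAdmissible R K M) : IsRBeable R (normalState K)
      (directSumAlgebra isStarProjection_privProj hM.privProj_mem) := by
  have hKs := hK.isSelfAdjoint
  have hMmax := (isMaximalAbelianIn_iff hR hKs).1 hM.maximalAbelian
  have hMclosed := isClosed_of_maximal_isAbelianIn (isClosed_vNRestriction hR hKs) hMmax
  refine ⟨isClosed_directSumAlgebra hMclosed, ?_, fun A hA => ?_, fun U hU hUR hUρ => ?_⟩
  · exact isBeable_directSumAlgebra (ρ := normalStateLinearMap hK)
      (normalState_star_mul_self_nonneg hK) (normalState_one hK) (normalState_mul_privProj hK)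
      hMclosed hMmax.prop.2 (mul_privProj_of_subset_restriction hM.upper)
  · refine ⟨privProj_mem_centralizer hR hKs A (Set.mem_insert_of_mem K hA), hM.lower ⟨A, ?_, rfl⟩⟩
    exact Set.mem_iInter₂.2 fun V hV => hV hA
  · have hUF : U ∈ (insert K R).centralizer :=
      Set.forall_mem_insert.2 ⟨(commute_of_normalState_conj hU hUρ).symm, hUR⟩
    exact image_conj_directSumAlgebra hU fun A hA =>
      (vNRestriction_subset hR hKs (hMmax.prop.1 hA) U hUF).symm

theorem IsRBeable.commutator_mul_privProj (hR : ∀ A ∈ R, star A ∈ R) (hK : IsDensityOperator K)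
    (hB : IsRBeable R (normalState K) B) :
    ∀ A ∈ B, ∀ X ∈ B, (A * X - X * A) * privProj R K = 0 := by
  intro A hA X hX
  refine mul_privProj_eq_zero hR hB.priv fun Y hY => mul_eq_zero_of_normalState_eq_zero hK ?_
  have hstar : star ((A * X - X * A) * Y) ∈ B :=
    star_mem (mul_mem (sub_mem (mul_mem hA hX) (mul_mem hX hA)) hY)
  simpa [mul_assoc] using
    hB.beable.map_mul_commutator_mul_eq_zero ⟨A, hA⟩ ⟨X, hX⟩ ⟨_, hstar⟩ ⟨Y, hY⟩

theorem IsRBeable.conj_mem (hK : IsDensityOperator K) (hB : IsRBeable R (normalState K) B) :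
    ∀ U ∈ unitary (H →L[ℂ] H), U ∈ (insert K R).centralizer → ∀ A ∈ B, U * A * star U ∈ B := by
  intro U hU hUF A hA
  have h := hB.definable U hU (Set.centralizer_subset (Set.subset_insert K R) hUF)
    (normalState_conj_unitary hK hU (hUF K (Set.mem_insert K R)).symm)
  rw [← SetLike.mem_coe, ← h]
  exact ⟨A, hA, rfl⟩

protected theorem IsRBeable.privProj_mem_centralizer (hR : ∀ A ∈ R, star A ∈ R)
    (hK : IsDensityOperator K) (hB : IsRBeable R (normalState K) B) :
    privProj R K ∈ (B : Set (H →L[ℂ] H)).centralizer :=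
  mem_centralizer_of_commutator_mul_eq_zero isStarProjection_privProj
    (privProj_mem_centralizer hR hK.isSelfAdjoint)
    (hB.commutator_mul_privProj hR hK) (hB.conj_mem hK)

theorem IsRBeable.isAbelianIn_restriction (hR : ∀ A ∈ R, star A ∈ R) (hK : IsDensityOperator K)
    (hB : IsRBeable R (normalState K) B) :
    IsAbelianIn (vNRestriction hR hK.isSelfAdjoint : Set (H →L[ℂ] H))
      (restriction B isStarProjection_privProj (hB.privProj_mem_centralizer hR hK)) := by
  have he := (isStarProjection_privProj (R := R) (K := K)).isIdempotentElem
  have heB := hB.privProj_mem_centralizer hR hK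
  constructor
  · rintro _ ⟨A, hA, rfl⟩
    refine ⟨A * privProj R K, ?_, (mul_assoc A _ _).trans (congr_arg _ he)⟩
    change _ ∈ (vNAlgebra (insert K R) : Set (H →L[ℂ] H))
    rw [coe_vNAlgebra_insert hR hK.isSelfAdjoint]
    exact mul_mem_centralizer_centralizer_of_commutator_mul_eq_zero isStarProjection_privProj
      (star_mem_insert hR hK.isSelfAdjoint)
      (privProj_mem_centralizer hR hK.isSelfAdjoint)
      (privProj_mem_centralizer_centralizer hR hK.isSelfAdjoint)
      (hB.commutator_mul_privProj hR hK) (hB.conj_mem hK) hA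
  · rintro _ ⟨A, hA, rfl⟩ _ ⟨X, hX, rfl⟩
    have hcomm := hB.commutator_mul_privProj hR hK A hA X hX
    rw [sub_mul, sub_eq_zero] at hcomm
    exact (mul_mul_mul_eq_of_comm he (heB X hX)).trans
      (hcomm.trans (mul_mul_mul_eq_of_comm he (heB A hA)).symm)

theorem IsRBeable.isAdmissible_of_restriction_le (hR : ∀ A ∈ R, star A ∈ R)
    (hK : IsDensityOperator K) (hB : IsRBeable R (normalState K) B)
    (hM : Maximal (IsAbelianIn (vNRestriction hR hK.isSelfAdjoint : Set (H →L[ℂ] H))) M)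
    (hBM : restriction B isStarProjection_privProj (hB.privProj_mem_centralizer hR hK) ≤ M) :
    IsAdmissible R K M := by
  have hMmax := (isMaximalAbelianIn_iff hR hK.isSelfAdjoint).2 hM
  refine ⟨?_, hMmax.prop.1, hMmax⟩
  rintro _ ⟨A, hA, rfl⟩
  refine mem_of_maximal_isAbelianIn hM ?_ fun X hX => ?_
  · rw [← SetLike.mem_coe, coe_vNRestriction]
    exact ⟨A, Set.biInter_subset_biInter_left
      (fun V hV => (Set.subset_insert K R).trans hV) hA, rfl⟩
  have hXe : X * privProj R K = X := mul_privProj_of_subset_restriction hMmax.prop.1 X hX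
  have heX : privProj R K * X = X := mul_eq_of_forall_mul_eq isStarProjection_privProj
    (fun _ => star_mem) (mul_privProj_of_subset_restriction hMmax.prop.1) hX
  have hXR : X ∈ R.centralizer := fun T hT => by
    have hcomm : T * privProj R K * X = X * (T * privProj R K) :=
      hM.prop.2 _ (hBM ⟨T, hB.priv hT, rfl⟩) X hX
    have hTe := hB.privProj_mem_centralizer hR hK T (hB.priv hT)
    rwa [mul_assoc, heX, hTe, ← mul_assoc, hXe] at hcomm
  rw [vN_eq_centralizer_centralizer hR] at hA
  rw [← mul_assoc, hA X hXR, mul_assoc, hXe, mul_assoc, heX]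

theorem IsRBeable.le_directSumAlgebra (hR : ∀ A ∈ R, star A ∈ R) (hK : IsDensityOperator K)
    (hB : IsRBeable R (normalState K) B) (heM : privProj R K ∈ M)
    (hBM : restriction B isStarProjection_privProj (hB.privProj_mem_centralizer hR hK) ≤ M) :
    B ≤ directSumAlgebra isStarProjection_privProj heM := fun A hA =>
  ⟨hB.privProj_mem_centralizer hR hK A hA, hBM ⟨A, hA, rfl⟩⟩

theorem IsAdmissible.isMaximalRBeable (hR : ∀ A ∈ R, star A ∈ R) (hK : IsDensityOperator K)
    (hM : IsAdmissible R K M) : IsMaximalRBeable R (normalState K)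
      (directSumAlgebra isStarProjection_privProj hM.privProj_mem) := by
  refine ⟨isRBeable_directSumAlgebra hR hK hM, fun B hB hMB => ?_⟩
  have hMmax := (isMaximalAbelianIn_iff hR hK.isSelfAdjoint).1 hM.maximalAbelian
  have hMe := mul_privProj_of_subset_restriction hM.upper
  refine hB.le_directSumAlgebra hR hK hM.privProj_mem <|
    hMmax.le_of_ge (hB.isAbelianIn_restriction hR hK) fun X hX => ?_
  exact ⟨X, hMB (mem_directSumAlgebra_of_mem hMe hX), hMe X hX⟩

end Classification

end BeableAlgebra

open BeableAlgebra in
theorem mainTheorem2_general {H : Type*} [NormedAddCommGroup H] [InnerProductSpace ℂ H]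
    [CompleteSpace H] {R : Set (H →L[ℂ] H)} (hR : ∀ A ∈ R, star A ∈ R) {K : H →L[ℂ] H}
    (hK : IsDensityOperator K) :
    IsLeast {Y : Submodule ℂ H | IsClosed (Y : Set H) ∧ Set.range K ⊆ Y ∧
        ∀ A ∈ R, ∀ y ∈ Y, A y ∈ Y} (privSubspace R K) ∧
    (∀ B : StarSubalgebra ℂ (H →L[ℂ] H), IsMaximalRBeable R (normalState K) B →
      ∃ M : NonUnitalStarSubalgebra ℂ (H →L[ℂ] H), IsAdmissible R K M ∧
        (B : Set (H →L[ℂ] H)) = directSum R K M) ∧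
    (∀ M : NonUnitalStarSubalgebra ℂ (H →L[ℂ] H), IsAdmissible R K M →
      ∃ B : StarSubalgebra ℂ (H →L[ℂ] H), (B : Set (H →L[ℂ] H)) = directSum R K M ∧
        IsMaximalRBeable R (normalState K) B) := by
  refine ⟨isLeast_privSubspace hR, fun B hB => ?_, fun M hM => ?_⟩
  · obtain ⟨M, hBM, hMmax⟩ := (hB.prop.isAbelianIn_restriction hR hK).exists_le_maximal
    have hM := hB.prop.isAdmissible_of_restriction_le hR hK hMmax hBM
    have hle := hB.prop.le_directSumAlgebra hR hK hM.privProj_mem hBM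
    have hB_eq := hle.antisymm (hB.le_of_ge (isRBeable_directSumAlgebra hR hK hM) hle)
    exact ⟨M, hM, (congr_arg _ hB_eq).trans hM.coe_directSumAlgebra⟩
  · exact ⟨_, hM.coe_directSumAlgebra, hM.isMaximalRBeable hR hK⟩

theorem mainTheorem2 {H : Type*} [NormedAddCommGroup H] [InnerProductSpace ℂ H] [CompleteSpace H]
    (R : Set (H →L[ℂ] H)) (hR : ∀ A ∈ R, IsSelfAdjoint A)
    (hcomm : ∀ A ∈ R, ∀ B ∈ R, A * B = B * A)
    (K : H →L[ℂ] H) (hK : BeableAlgebra.IsDensityOperator K) :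
    IsLeast {Y : Submodule ℂ H | IsClosed (Y : Set H) ∧ Set.range K ⊆ Y ∧
        ∀ A ∈ R, ∀ y ∈ Y, A y ∈ Y} (BeableAlgebra.privSubspace R K) ∧
    (∀ B : StarSubalgebra ℂ (H →L[ℂ] H),
      BeableAlgebra.IsMaximalRBeable R (BeableAlgebra.normalState K) B →
      ∃ M : NonUnitalStarSubalgebra ℂ (H →L[ℂ] H), BeableAlgebra.IsAdmissible R K M ∧
        (B : Set (H →L[ℂ] H)) = BeableAlgebra.directSum R K M) ∧
    (∀ M : NonUnitalStarSubalgebra ℂ (H →L[ℂ] H), BeableAlgebra.IsAdmissible R K M →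
      ∃ B : StarSubalgebra ℂ (H →L[ℂ] H),
        (B : Set (H →L[ℂ] H)) = BeableAlgebra.directSum R K M ∧
        BeableAlgebra.IsMaximalRBeable R (BeableAlgebra.normalState K) B) :=
  mainTheorem2_general (fun A hA => by rwa [(hR A hA).star_eq]) hK
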